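/- Let $F$ be a field of characteristic $p>0$. All algebras below are finite-dimensional soluble restricted Lie algebras $(L,[p])$ over $F$, and a class of such algebras is assumed closed under isomorphism. A $[p]$-subalgebra (respectively $[p]$-ideal) of $(L,[p])$ is a Lie subalgebra (respectively ideal) closed under the $p$-operation; it is, respectively its quotient is, again a restricted Lie algebra. An algebra $L$ is primitive if it has a minimal (non-zero) $[p]$-ideal $A$ with $\mathcal{C}_L(A)=A$. A $p$-homomorph is a non-empty class closed under quotients by $[p]$-ideals. A $p$-Schunck class is a non-empty class $\mathfrak{X}$ such that, for every algebra $L$, one has $L\in\mathfrak{X}$ if and only if every primitive quotient $L/K$ of $L$ by a $[p]$-ideal $K$ is in $\mathfrak{X}$. Let $\mathfrak{X}$ be a $p$-homomorph. A $[p]$-subalgebra $U$ of $L$ is $\mathfrak{X}$-maximal in $L$ if it is maximal among the $[p]$-subalgebras of $L$ that belong to $\mathfrak{X}$; it is an $\mathfrak{X}$-projector of $L$ if $(U+K)/K$ is $\mathfrak{X}$-maximal in $L/K$ for every $[p]$-ideal $K$ of $L$; and it is an $\mathfrak{X}$-covering subalgebra of $L$ if $U\in\mathfrak{X}$ and, whenever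 $V$ is a $[p]$-subalgebra of $L$ containing $U$ and $K$ is a $[p]$-ideal of $V$ with $V/K\in\mathfrak{X}$, one has $U+K=V$. **Theorem.** For a $p$-homomorph $\mathfrak{X}$ the following are equivalent: (a) $\mathfrak{X}$ is a Gaschütz class, that is, every algebra $L$ has an $\mathfrak{X}$-covering subalgebra; (b) $\mathfrak{X}$ is projective, that is, every algebra $L$ has an $\mathfrak{X}$-projector; (c) $\mathfrak{X}$ is a $p$-Schunck class. -/

import Mathlib

universe u v w

namespace RestrictedLie

/-! ### Restricted Lie algebras -/

section Jacobson

variable {L : Type v} [LieRing L]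

/-- `adCoeff x y n i` is the coefficient of `T ^ i` in `(ad (T x + y)) ^ n (x)`, where `T` is an
indeterminate; the recursion is the expansion of
`(ad (T x + y)) ^ (n + 1) (x) = T [x, (ad (T x + y)) ^ n (x)] + [y, (ad (T x + y)) ^ n (x)]`. -/
def adCoeff (x y : L) : ℕ → ℕ → L
  | 0, 0 => x
  | 0, _ + 1 => 0
  | n + 1, 0 => ⁅y, adCoeff x y n 0⁆
  | n + 1, i + 1 => ⁅x, adCoeff x y n i⁆ + ⁅y, adCoeff x y n (i + 1)⁆

/-- The function `S(x, y) = ∑_{i = 1}^{p - 1} s_i(x, y)` measuring the non-additivity of a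
`p`-operation, where `i s_i(x, y)` is the coefficient of `T ^ (i - 1)` in
`(ad (T x + y)) ^ (p - 1) (x)`. -/
def jacobsonSum (p : ℕ) (F : Type u) [Field F] [LieAlgebra F L] (x y : L) : L :=
  ∑ i ∈ Finset.Icc 1 (p - 1), (i : F)⁻¹ • adCoeff x y (p - 1) (i - 1)

end Jacobson

/-- A `p`-operation `x ↦ x^[p]` on a Lie algebra `L` over `F`. -/
structure POperation (p : ℕ) (F : Type u) [Field F] (L : Type v) [LieRing L] [LieAlgebra F L] where
  toFun : L → L
  ad_pow (x : L) : LieAlgebra.ad F L x ^ p = LieAlgebra.ad F L (toFun x)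
  map_smul (c : F) (x : L) : toFun (c • x) = c ^ p • toFun x
  map_add (x y : L) : toFun (x + y) = toFun x + toFun y + jacobsonSum p F x y

/-- A finite-dimensional soluble restricted Lie algebra `(L, [p])` over `F`. -/
structure Alg (p : ℕ) (F : Type u) [Field F] : Type (max u (v + 1)) where
  carrier : Type v
  [lieRing : LieRing carrier]
  [lieAlgebra : LieAlgebra F carrier]
  [finiteDimensional : FiniteDimensional F carrier]
  [isSolvable : LieAlgebra.IsSolvable carrier]
  pOp : POperation p F carrier

attribute [instance] Alg.lieRing Alg.lieAlgebra Alg.finiteDimensional Alg.isSolvable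

variable {p : ℕ} {F : Type u} [Field F]

instance : CoeSort (Alg.{u, v} p F) (Type v) := ⟨Alg.carrier⟩

/-- Isomorphism of restricted Lie algebras. -/
def Iso (L M : Alg.{u, v} p F) : Prop :=
  ∃ e : L ≃ₗ⁅F⁆ M, ∀ x : L, e (L.pOp.toFun x) = M.pOp.toFun (e x)

/-- A `[p]`-subalgebra of `(L, [p])`. -/
structure PSubalgebra (L : Alg.{u, v} p F) extends LieSubalgebra F L.carrier where
  pOp_mem : ∀ x ∈ toLieSubalgebra, L.pOp.toFun x ∈ toLieSubalgebra

/-- A `[p]`-ideal of `(L, [p])`. -/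
structure PIdeal (L : Alg.{u, v} p F) where
  toLieIdeal : LieIdeal F L
  pOp_mem : ∀ x ∈ toLieIdeal, L.pOp.toFun x ∈ toLieIdeal

/-! ### Subalgebras and quotients as restricted Lie algebras -/

theorem map_adCoeff {L : Type v} {M : Type w} [LieRing L] [LieRing M] [LieAlgebra F L]
    [LieAlgebra F M] (f : L →ₗ⁅F⁆ M) (x y : L) (n i : ℕ) :
    f (adCoeff x y n i) = adCoeff (f x) (f y) n i := by
  induction n generalizing i with
  | zero => cases i <;> simp [adCoeff]
  | succ n ih => cases i <;> simp [adCoeff, ih]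

theorem map_jacobsonSum {L : Type v} {M : Type w} [LieRing L] [LieRing M] [LieAlgebra F L]
    [LieAlgebra F M] (f : L →ₗ⁅F⁆ M) (x y : L) :
    f (jacobsonSum p F x y) = jacobsonSum p F (f x) (f y) := by
  simp [jacobsonSum, map_adCoeff]

theorem adCoeff_mem {L : Type v} [LieRing L] [LieAlgebra F L] (I : LieIdeal F L) (x : L) {y : L}
    (hy : y ∈ I) (n i : ℕ) (h : i < n) : adCoeff x y n i ∈ I := by
  induction n generalizing i with
  | zero => omega
  | succ n ih =>
    cases i with
    | zero => exact lie_mem_left F L I _ _ hy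
    | succ i =>
      exact add_mem (lie_mem_right F L I _ _ (ih i (by omega))) (lie_mem_left F L I _ _ hy)

theorem jacobsonSum_mem {L : Type v} [LieRing L] [LieAlgebra F L] (I : LieIdeal F L) (x : L)
    {y : L} (hy : y ∈ I) : jacobsonSum p F x y ∈ I := by
  refine sum_mem fun i hi => I.smul_mem _ (adCoeff_mem I x hy _ _ ?_)
  rw [Finset.mem_Icc] at hi
  omega

/-- A `[p]`-subalgebra, regarded as a restricted Lie algebra. -/
def PSubalgebra.toAlg {L : Alg.{u, v} p F} (U : PSubalgebra L) : Alg.{u, v} p F where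
  carrier := U.toLieSubalgebra
  isSolvable := Function.Injective.lieAlgebra_isSolvable (f := U.toLieSubalgebra.incl) Subtype.val_injective
  pOp :=
    { toFun := fun x => ⟨L.pOp.toFun x, U.pOp_mem x x.2⟩
      ad_pow := fun x => by
        ext y
        rw [LieSubalgebra.coe_ad_pow, L.pOp.ad_pow]
        rfl
      map_smul := fun c x => Subtype.ext (L.pOp.map_smul c x)
      map_add := fun x y => Subtype.ext (by
        have h := map_jacobsonSum (p := p) U.toLieSubalgebra.incl x y
        exact (L.pOp.map_add x y).trans (congrArg _ h.symm)) }

/-- The canonical map `L → L / K`, as a homomorphism of Lie algebras. -/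
def PIdeal.proj {L : Alg.{u, v} p F} (K : PIdeal L) : L →ₗ⁅F⁆ L ⧸ K.toLieIdeal :=
  { K.toLieIdeal.toSubmodule.mkQ with map_lie' := rfl }

theorem PIdeal.proj_surjective {L : Alg.{u, v} p F} (K : PIdeal L) :
    Function.Surjective K.proj :=
  K.toLieIdeal.toSubmodule.mkQ_surjective

theorem PIdeal.proj_eq_zero {L : Alg.{u, v} p F} (K : PIdeal L) (x : L) :
    K.proj x = 0 ↔ x ∈ K.toLieIdeal :=
  Submodule.Quotient.mk_eq_zero K.toLieIdeal.toSubmodule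

theorem PIdeal.proj_pOp {L : Alg.{u, v} p F} (K : PIdeal L) (x y : L) (h : K.proj x = K.proj y) :
    K.proj (L.pOp.toFun x) = K.proj (L.pOp.toFun y) := by
  have hm : x - y ∈ K.toLieIdeal := by rw [← K.proj_eq_zero, map_sub, h, sub_self]
  have e : x = y + (x - y) := by abel
  rw [e, L.pOp.map_add, map_add, map_add, (K.proj_eq_zero _).2 (K.pOp_mem _ hm),
    (K.proj_eq_zero _).2 (jacobsonSum_mem _ _ hm), add_zero, add_zero]

/-- The `p`-operation `(x + K)^[p] = x^[p] + K` on `L / K`. -/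
def PIdeal.quotientPOp {L : Alg.{u, v} p F} (K : PIdeal L) : L ⧸ K.toLieIdeal → L ⧸ K.toLieIdeal :=
  Quotient.lift (fun x : L => K.proj (L.pOp.toFun x))
    fun x y h => K.proj_pOp x y (Quotient.sound h)

theorem PIdeal.quotientPOp_proj {L : Alg.{u, v} p F} (K : PIdeal L) (x : L) :
    K.quotientPOp (K.proj x) = K.proj (L.pOp.toFun x) := rfl

theorem PIdeal.ad_proj_pow {L : Alg.{u, v} p F} (K : PIdeal L) (x y : L) (n : ℕ) :
    (LieAlgebra.ad F (L ⧸ K.toLieIdeal) (K.proj x) ^ n) (K.proj y) =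
      K.proj ((LieAlgebra.ad F L x ^ n) y) := by
  induction n with
  | zero => rfl
  | succ n ih => rw [pow_succ', pow_succ', Module.End.mul_apply, ih]; rfl

/-- The quotient `(L / K, [p])` by a `[p]`-ideal. -/
def Alg.quotient (L : Alg.{u, v} p F) (K : PIdeal L) : Alg.{u, v} p F where
  carrier := L ⧸ K.toLieIdeal
  finiteDimensional := inferInstanceAs (FiniteDimensional F (L ⧸ K.toLieIdeal.toSubmodule))
  isSolvable := K.proj_surjective.lieAlgebra_isSolvable
  pOp :=
    { toFun := K.quotientPOp
      ad_pow := fun x => by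
        obtain ⟨x, rfl⟩ := K.proj_surjective x
        refine LinearMap.ext fun y => ?_
        obtain ⟨y, rfl⟩ := K.proj_surjective y
        rw [K.ad_proj_pow, L.pOp.ad_pow]
        rfl
      map_smul := fun c x => by
        obtain ⟨x, rfl⟩ := K.proj_surjective x
        rw [← map_smul, K.quotientPOp_proj, L.pOp.map_smul, map_smul, K.quotientPOp_proj]
      map_add := fun x y => by
        obtain ⟨x, rfl⟩ := K.proj_surjective x
        obtain ⟨y, rfl⟩ := K.proj_surjective y
        rw [← map_add, K.quotientPOp_proj, L.pOp.map_add, map_add, map_add, map_jacobsonSum,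
          K.quotientPOp_proj, K.quotientPOp_proj] }

/-- The `[p]`-subalgebra `(U + K) / K` of `L / K`. -/
def PSubalgebra.map {L : Alg.{u, v} p F} (U : PSubalgebra L) (K : PIdeal L) :
    PSubalgebra (L.quotient K) where
  toLieSubalgebra := LieSubalgebra.map (L₂ := L ⧸ K.toLieIdeal) K.proj U.toLieSubalgebra
  pOp_mem := by
    rintro _ ⟨x, hx, rfl⟩
    exact ⟨L.pOp.toFun x, U.pOp_mem x hx, rfl⟩

/-! ### Classes of soluble restricted Lie algebras -/

/-- A minimal (nonzero) `[p]`-ideal. -/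
def PIdeal.IsMinimal {L : Alg.{u, v} p F} (A : PIdeal L) : Prop :=
  A.toLieIdeal ≠ ⊥ ∧
    ∀ B : PIdeal L, B.toLieIdeal ≠ ⊥ → B.toLieIdeal ≤ A.toLieIdeal → B.toLieIdeal = A.toLieIdeal

/-- `L` is primitive: it has a minimal `[p]`-ideal `A` which is its own centralizer in `L`. -/
def IsPrimitive (L : Alg.{u, v} p F) : Prop :=
  ∃ A : PIdeal L, A.IsMinimal ∧ ∀ x : L, x ∈ A.toLieIdeal ↔ ∀ a ∈ A.toLieIdeal, ⁅x, a⁆ = 0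

/-- A collection of soluble restricted Lie algebras is a class if it is closed under
isomorphism. -/
def IsClass (X : Set (Alg.{u, v} p F)) : Prop :=
  ∀ L M : Alg.{u, v} p F, L ∈ X → Iso L M → M ∈ X

/-- The class of quotients of algebras in `X`. -/
def quot (X : Set (Alg.{u, v} p F)) : Set (Alg.{u, v} p F) :=
  {M | ∃ L ∈ X, ∃ K : PIdeal L, Iso (L.quotient K) M}

/-- The class of all algebras whose primitive quotients are in `X`. -/
def prim (X : Set (Alg.{u, v} p F)) : Set (Alg.{u, v} p F) :=
  {L | ∀ K : PIdeal L, IsPrimitive (L.quotient K) → L.quotient K ∈ X}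

/-- A `p`-homomorph: a non-empty class closed under quotients. -/
def IsPHomomorph (X : Set (Alg.{u, v} p F)) : Prop :=
  IsClass X ∧ X.Nonempty ∧ quot X = X

/-- A `p`-Schunck class: a non-empty class `X` consisting exactly of the algebras all of whose
primitive quotients are in `X`. -/
def IsPSchunckClass (X : Set (Alg.{u, v} p F)) : Prop :=
  IsClass X ∧ X.Nonempty ∧ prim X = X

/-- `U` is maximal among the `[p]`-subalgebras of `L` which are in `X`. -/
def PSubalgebra.IsMaximalIn {L : Alg.{u, v} p F} (U : PSubalgebra L) (X : Set (Alg.{u, v} p F)) :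
    Prop :=
  U.toAlg ∈ X ∧ ∀ V : PSubalgebra L, V.toAlg ∈ X →
    U.toLieSubalgebra ≤ V.toLieSubalgebra → V.toLieSubalgebra = U.toLieSubalgebra

/-- `U` is an `X`-projector of `L`: for every `[p]`-ideal `K` of `L`, the `[p]`-subalgebra
`(U + K) / K` is `X`-maximal in `L / K`. -/
def PSubalgebra.IsProjector {L : Alg.{u, v} p F} (U : PSubalgebra L) (X : Set (Alg.{u, v} p F)) :
    Prop :=
  ∀ K : PIdeal L, (U.map K).IsMaximalIn X

/-- `U` is an `X`-covering subalgebra of `L`: it is in `X` and, whenever `V` is a `[p]`-subalgebra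
of `L` containing `U` and `K` is a `[p]`-ideal of `V` with `V / K` in `X`, one has `U + K = V`. -/
def PSubalgebra.IsCovering {L : Alg.{u, v} p F} (U : PSubalgebra L) (X : Set (Alg.{u, v} p F)) :
    Prop :=
  U.toAlg ∈ X ∧ ∀ V : PSubalgebra L, U.toLieSubalgebra ≤ V.toLieSubalgebra →
    ∀ K : PIdeal V.toAlg, V.toAlg.quotient K ∈ X →
      U.toLieSubalgebra.toSubmodule ⊔
          K.toLieIdeal.toSubmodule.map (V.toLieSubalgebra.incl : V.toLieSubalgebra →ₗ[F] L) =
        V.toLieSubalgebra.toSubmodule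

/-- Every soluble restricted Lie algebra has an `X`-covering subalgebra. -/
def IsGaschutzClass (X : Set (Alg.{u, v} p F)) : Prop :=
  ∀ L : Alg.{u, v} p F, ∃ U : PSubalgebra L, U.IsCovering X

/-- Every soluble restricted Lie algebra has an `X`-projector. -/
def IsProjective (X : Set (Alg.{u, v} p F)) : Prop :=
  ∀ L : Alg.{u, v} p F, ∃ U : PSubalgebra L, U.IsProjector X

end RestrictedLie

/-! The content lies in 2 → 3 and 3 → 1; a covering subalgebra is a projector because its covering
property can be applied to the full preimage of a larger `X`-subalgebra of a quotient.

2 → 3: take `L ∉ X` of least dimension among the algebras whose primitive quotients lie in `X`.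
Proper quotients of `L` are in `X`, so a projector `E` of `L` is proper and supplements every
nonzero `[p]`-ideal. This forces `L` to be primitive (`isPrimitive_of_supplement`), so `L ∈ X` after
all.

3 → 1: induct on dimension. If some proper quotient `L / K` is outside `X`, a covering subalgebra of
`L / K` is proper, and a covering subalgebra of its preimage covers in `L`
(`PSubalgebra.Covers.trans`). If `L ∉ X` but all proper quotients are in `X`, then `L` is primitive.
Its self-centralizing minimal ideal `A` has a complement (`PIdeal.IsMinimal.exists_complement`),
which is isomorphic to `L / A` and is a covering subalgebra.

The complement is the centralizer of an element `b` that is central modulo `A` and acts invertibly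
on `A`. When the centre is zero, the `p`-operation vanishes on abelian ideals, so these are
automatically `[p]`-ideals. -/

namespace RestrictedLie

variable {p : ℕ} {F : Type u} [Field F]

/-! ### Homomorphisms of restricted Lie algebras -/

/-- A homomorphism of restricted Lie algebras. -/
structure PHom (L M : Alg.{u, v} p F) where
  toLieHom : L.carrier →ₗ⁅F⁆ M.carrier
  map_pOp (x : L.carrier) : toLieHom (L.pOp.toFun x) = M.pOp.toFun (toLieHom x)

namespace PHom

variable {L M N : Alg.{u, v} p F}

instance : CoeFun (PHom L M) fun _ => L.carrier → M.carrier := ⟨fun f => f.toLieHom⟩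

/-- The composition of homomorphisms of restricted Lie algebras. -/
def comp (g : PHom M N) (f : PHom L M) : PHom L N where
  toLieHom := g.toLieHom.comp f.toLieHom
  map_pOp x := by simp [f.map_pOp, g.map_pOp]

@[simp]
theorem comp_apply (g : PHom M N) (f : PHom L M) (x : L) : g.comp f x = g (f x) := rfl

/-- The preimage of a `[p]`-subalgebra. -/
def comap (f : PHom L M) (U : PSubalgebra M) : PSubalgebra L where
  toLieSubalgebra := U.toLieSubalgebra.comap f.toLieHom
  pOp_mem x hx := by
    change f (L.pOp.toFun x) ∈ U.toLieSubalgebra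
    rw [f.map_pOp]
    exact U.pOp_mem _ hx

/-- The image of a `[p]`-subalgebra. -/
def map (f : PHom L M) (U : PSubalgebra L) : PSubalgebra M where
  toLieSubalgebra := U.toLieSubalgebra.map f.toLieHom
  pOp_mem := by
    rintro _ ⟨x, hx, rfl⟩
    exact ⟨L.pOp.toFun x, U.pOp_mem x hx, f.map_pOp x⟩

/-- The preimage of a `[p]`-ideal. -/
def comapIdeal (f : PHom L M) (K : PIdeal M) : PIdeal L where
  toLieIdeal := K.toLieIdeal.comap f.toLieHom
  pOp_mem x hx := by
    rw [LieIdeal.mem_comap] at hx ⊢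
    rw [f.map_pOp]
    exact K.pOp_mem _ hx

@[simp]
theorem mem_comapIdeal {f : PHom L M} {K : PIdeal M} {x : L} :
    x ∈ (f.comapIdeal K).toLieIdeal ↔ f x ∈ K.toLieIdeal := LieIdeal.mem_comap

/-- The image of a `[p]`-ideal under a surjective homomorphism. -/
def mapIdeal (f : PHom L M) (hf : Function.Surjective f) (K : PIdeal L) : PIdeal M where
  toLieIdeal :=
    { K.toLieIdeal.toSubmodule.map (f.toLieHom : L.carrier →ₗ[F] M.carrier) with
      lie_mem := by
        rintro x _ ⟨y, hy, rfl⟩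
        obtain ⟨x, rfl⟩ := hf x
        exact ⟨⁅x, y⁆, lie_mem_right F L K.toLieIdeal _ _ hy, f.toLieHom.map_lie x y⟩ }
  pOp_mem := by
    rintro _ ⟨x, hx, rfl⟩
    exact ⟨L.pOp.toFun x, K.pOp_mem x hx, f.map_pOp x⟩

@[simp]
theorem mem_mapIdeal {f : PHom L M} {hf : Function.Surjective f} {K : PIdeal L} {y : M} :
    y ∈ (f.mapIdeal hf K).toLieIdeal ↔ ∃ x ∈ K.toLieIdeal, f x = y := Iff.rfl

/-- The corestriction of a homomorphism to a `[p]`-subalgebra containing its range. -/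
def codRestrict (f : PHom L M) (U : PSubalgebra M) (h : ∀ x, f x ∈ U.toLieSubalgebra) :
    PHom L U.toAlg where
  toLieHom :=
    { toFun := fun x => ⟨f x, h x⟩
      map_add' := fun x y => Subtype.ext (map_add f.toLieHom x y)
      map_smul' := fun c x => Subtype.ext (map_smul f.toLieHom c x)
      map_lie' := fun {x y} => Subtype.ext (LieHom.map_lie f.toLieHom x y) }
  map_pOp x := Subtype.ext (f.map_pOp x)

theorem exists_lift (g : PHom L M) (hg : Function.Surjective g) (h : PHom L N)
    (hk : ∀ x, g x = 0 → h x = 0) : ∃ k : PHom M N, ∀ x, k (g x) = h x := by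
  have key : ∀ x y, g x = g y → h x = h y := fun x y e => by
    rw [← sub_eq_zero, ← map_sub]
    exact hk _ (by rw [map_sub, e, sub_self])
  have hs : ∀ x, h (Function.surjInv hg (g x)) = h x := fun x =>
    key _ _ (Function.surjInv_eq hg _)
  refine ⟨⟨{ toFun := fun y => h (Function.surjInv hg y)
             map_add' := hg.forall₂.2 fun x y => ?_
             map_smul' := fun c => hg.forall.2 fun x => ?_
             map_lie' := fun {x y} => ?_ }, hg.forall.2 fun x => ?_⟩, hs⟩
  · rw [← map_add, hs, hs, hs, map_add]
  · rw [← map_smul, hs, hs, map_smul]; rfl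
  · obtain ⟨x, rfl⟩ := hg x
    obtain ⟨y, rfl⟩ := hg y
    rw [← LieHom.map_lie, hs, hs, hs, LieHom.map_lie]
  · change h (Function.surjInv hg _) = N.pOp.toFun (h _)
    rw [← g.map_pOp, hs, hs, h.map_pOp]

/-- Comparing two surjections with the same kernel replaces the isomorphism theorems, so iterated
quotients never need to be identified by hand. -/
theorem exists_iso (g : PHom L M) (hg : Function.Surjective g) (h : PHom L N)
    (hh : Function.Surjective h) (hk : ∀ x, g x = 0 ↔ h x = 0) : Iso M N := by
  obtain ⟨k, hkg⟩ := exists_lift g hg h fun x => (hk x).1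
  have hb : Function.Bijective k.toLieHom := by
    refine ⟨(injective_iff_map_eq_zero k.toLieHom).2 (hg.forall.2 fun x hx => ?_), fun y => ?_⟩
    · exact (hk x).2 ((hkg x).symm.trans hx)
    · obtain ⟨x, rfl⟩ := hh y
      exact ⟨g x, hkg x⟩
  exact ⟨LieEquiv.ofBijective k.toLieHom hb, k.map_pOp⟩

end PHom

theorem POperation.toFun_zero [Fact p.Prime] {L : Type v} [LieRing L] [LieAlgebra F L]
    (φ : POperation p F L) : φ.toFun 0 = 0 := by
  have h := φ.map_smul 0 0
  rwa [zero_smul, zero_pow (Fact.out : p.Prime).ne_zero, zero_smul] at h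

/-- The zero `[p]`-ideal. -/
def PIdeal.zero [Fact p.Prime] (L : Alg.{u, v} p F) : PIdeal L where
  toLieIdeal := ⊥
  pOp_mem x hx := by
    rw [LieSubmodule.mem_bot] at hx ⊢
    rw [hx, L.pOp.toFun_zero]

@[simp]
theorem PIdeal.mem_zero [Fact p.Prime] {L : Alg.{u, v} p F} {x : L} :
    x ∈ (PIdeal.zero L).toLieIdeal ↔ x = 0 := LieSubmodule.mem_bot x

/-- The kernel of a homomorphism. -/
def PHom.ker [Fact p.Prime] {L M : Alg.{u, v} p F} (f : PHom L M) : PIdeal L :=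
  f.comapIdeal (PIdeal.zero M)

@[simp]
theorem PHom.mem_ker [Fact p.Prime] {L M : Alg.{u, v} p F} {f : PHom L M} {x : L} :
    x ∈ f.ker.toLieIdeal ↔ f x = 0 := PHom.mem_comapIdeal.trans PIdeal.mem_zero

/-- The quotient map, as a homomorphism of restricted Lie algebras. -/
def PIdeal.mkHom {L : Alg.{u, v} p F} (K : PIdeal L) : PHom L (L.quotient K) where
  toLieHom := K.proj
  map_pOp _ := rfl

theorem PIdeal.mkHom_surjective {L : Alg.{u, v} p F} (K : PIdeal L) : Function.Surjective K.mkHom :=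
  K.proj_surjective

@[simp]
theorem PIdeal.mkHom_eq_zero {L : Alg.{u, v} p F} {K : PIdeal L} {x : L} :
    K.mkHom x = 0 ↔ x ∈ K.toLieIdeal := K.proj_eq_zero x

/-- The inclusion of a `[p]`-subalgebra. -/
def PSubalgebra.subtype {L : Alg.{u, v} p F} (U : PSubalgebra L) : PHom U.toAlg L where
  toLieHom := U.toLieSubalgebra.incl
  map_pOp _ := rfl

theorem PSubalgebra.subtype_injective {L : Alg.{u, v} p F} (U : PSubalgebra L) :
    Function.Injective U.subtype := Subtype.val_injective

theorem PSubalgebra.subtype_mem {L : Alg.{u, v} p F} (U : PSubalgebra L) (x : U.toAlg) :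
    U.subtype x ∈ U.toLieSubalgebra := x.2

theorem PSubalgebra.exists_subtype_eq {L : Alg.{u, v} p F} {U : PSubalgebra L} {x : L}
    (hx : x ∈ U.toLieSubalgebra) : ∃ y : U.toAlg, U.subtype y = x := ⟨⟨x, hx⟩, rfl⟩

/-- The whole algebra as a `[p]`-subalgebra. -/
def PSubalgebra.full (L : Alg.{u, v} p F) : PSubalgebra L where
  toLieSubalgebra := ⊤
  pOp_mem _ _ := LieSubalgebra.mem_top _

@[simp]
theorem PSubalgebra.mem_full {L : Alg.{u, v} p F} (x : L) :
    x ∈ (PSubalgebra.full L).toLieSubalgebra := LieSubalgebra.mem_top x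

/-! ### Dimensions -/

theorem PSubalgebra.finrank_toAlg_lt {L : Alg.{u, v} p F} {U : PSubalgebra L} {x : L}
    (hx : x ∉ U.toLieSubalgebra) :
    Module.finrank F U.toAlg.carrier < Module.finrank F L.carrier := by
  refine Submodule.finrank_lt (s := U.toLieSubalgebra.toSubmodule) fun h => hx ?_
  have : x ∈ U.toLieSubalgebra.toSubmodule := h ▸ Submodule.mem_top
  exact this

theorem PIdeal.finrank_quotient_lt {L : Alg.{u, v} p F} {K : PIdeal L} (hK : K.toLieIdeal ≠ ⊥) :
    Module.finrank F (L.quotient K).carrier < Module.finrank F L.carrier := by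
  have h1 := K.toLieIdeal.toSubmodule.finrank_quotient_add_finrank
  have h2 : 0 < Module.finrank F K.toLieIdeal.toSubmodule := by
    rw [Module.finrank_pos_iff, Submodule.nontrivial_iff_ne_bot]
    simpa using hK
  change Module.finrank F (L.carrier ⧸ K.toLieIdeal.toSubmodule) < _
  omega

/-! ### Soluble restricted Lie algebras -/

theorem lie_pOp (L : Alg.{u, v} p F) (x y : L) :
    ⁅L.pOp.toFun x, y⁆ = (LieAlgebra.ad F L x ^ p) y := by
  rw [L.pOp.ad_pow]; rfl

theorem exists_mem_ne_zero {L : Type v} [LieRing L] [LieAlgebra F L] {J : LieIdeal F L}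
    (hJ : J ≠ ⊥) : ∃ x ∈ J, x ≠ 0 := by
  simpa [LieSubmodule.eq_bot_iff] using hJ

theorem pOp_lie_eq_zero [Fact p.Prime] {L : Alg.{u, v} p F} {x y : L} (h : ⁅x, y⁆ = 0) :
    ⁅L.pOp.toFun x, y⁆ = 0 := by
  rw [lie_pOp]
  refine Module.End.pow_map_zero_of_le (Fact.out : p.Prime).one_le ?_
  rwa [pow_one, LieAlgebra.ad_apply]

/-- The centralizer of an element is a `[p]`-subalgebra. -/
def centralizer [Fact p.Prime] {L : Alg.{u, v} p F} (b : L) : PSubalgebra L where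
  carrier := {x | ⁅x, b⁆ = 0}
  add_mem' {x y} hx hy := by
    change ⁅x + y, b⁆ = 0
    rw [add_lie, show ⁅x, b⁆ = 0 from hx, show ⁅y, b⁆ = 0 from hy, add_zero]
  zero_mem' := zero_lie b
  smul_mem' c x hx := by
    change ⁅c • x, b⁆ = 0
    rw [smul_lie, show ⁅x, b⁆ = 0 from hx, smul_zero]
  lie_mem' {x y} hx hy := by
    change ⁅⁅x, y⁆, b⁆ = 0
    rw [lie_lie, show ⁅x, b⁆ = 0 from hx, show ⁅y, b⁆ = 0 from hy, lie_zero, lie_zero, sub_zero]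
  pOp_mem x hx := pOp_lie_eq_zero hx

@[simp]
theorem mem_centralizer [Fact p.Prime] {L : Alg.{u, v} p F} {b x : L} :
    x ∈ (centralizer b).toLieSubalgebra ↔ ⁅x, b⁆ = 0 := Iff.rfl

/-- The centre is a `[p]`-ideal. -/
def center [Fact p.Prime] (L : Alg.{u, v} p F) : PIdeal L where
  toLieIdeal := LieAlgebra.center F L
  pOp_mem x hx := by
    rw [LieModule.mem_maxTrivSubmodule] at hx ⊢
    intro y
    rw [← lie_skew, pOp_lie_eq_zero (by rw [← lie_skew, hx y, neg_zero]), neg_zero]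

@[simp]
theorem mem_center [Fact p.Prime] {L : Alg.{u, v} p F} {x : L} :
    x ∈ (center L).toLieIdeal ↔ ∀ y : L, ⁅y, x⁆ = 0 := LieModule.mem_maxTrivSubmodule F L L x

/-- For `x` in an abelian ideal `(ad x) ^ 2 = 0`, hence `ad (x^[p]) = (ad x) ^ p = 0` because `p ≥
2`. -/
theorem pOp_mem_center_of_mem_abelian [Fact p.Prime] {L : Alg.{u, v} p F} {J : LieIdeal F L}
    (hJ : ∀ x ∈ J, ∀ y ∈ J, ⁅x, y⁆ = 0) {x : L} (hx : x ∈ J) :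
    L.pOp.toFun x ∈ (center L).toLieIdeal := by
  refine mem_center.2 fun y => ?_
  rw [← lie_skew, lie_pOp, neg_eq_zero]
  refine Module.End.pow_map_zero_of_le (Fact.out : p.Prime).two_le ?_
  rw [pow_two, Module.End.mul_apply, LieAlgebra.ad_apply, LieAlgebra.ad_apply]
  exact hJ _ hx _ (lie_mem_left F L J _ _ hx)

theorem exists_abelian_lieIdeal (L : Alg.{u, v} p F) [Nontrivial L.carrier] :
    ∃ J : LieIdeal F L, J ≠ ⊥ ∧ ∀ x ∈ J, ∀ y ∈ J, ⁅x, y⁆ = 0 := by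
  by_contra! h
  have h1 : LieAlgebra.HasTrivialRadical F L := by
    rw [LieAlgebra.hasTrivialRadical_iff_no_abelian_ideals]
    intro I hI
    by_contra hne
    obtain ⟨x, hx, y, hy, hxy⟩ := h I hne
    have := hI.trivial ⟨x, hx⟩ ⟨y, hy⟩
    exact hxy (congrArg Subtype.val this)
  have h2 := h1.radical_eq_bot
  rw [LieAlgebra.radical_eq_top_of_isSolvable] at h2
  obtain ⟨x, hx⟩ := exists_ne (0 : L.carrier)
  exact hx ((LieSubmodule.mem_bot x).1 (h2 ▸ LieSubmodule.mem_top x))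

/-- A nonzero centre serves directly. If the centre is zero, the `p`-operation vanishes on any
abelian ideal, which is then closed under it. -/
theorem exists_abelian_pIdeal [Fact p.Prime] (L : Alg.{u, v} p F) [Nontrivial L.carrier] :
    ∃ A : PIdeal L, A.toLieIdeal ≠ ⊥ ∧ ∀ x ∈ A.toLieIdeal, ∀ y ∈ A.toLieIdeal, ⁅x, y⁆ = 0 := by
  by_cases hZ : (center L).toLieIdeal = ⊥
  · obtain ⟨J, hJ0, hJ⟩ := exists_abelian_lieIdeal L
    refine ⟨⟨J, fun x hx => ?_⟩, hJ0, hJ⟩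
    have h := pOp_mem_center_of_mem_abelian hJ hx
    rw [hZ, LieSubmodule.mem_bot] at h
    rw [h]
    exact J.zero_mem
  · exact ⟨center L, hZ, fun x _ y hy => mem_center.1 hy x⟩

theorem exists_isMinimal_le {L : Alg.{u, v} p F} (K : PIdeal L) (hK : K.toLieIdeal ≠ ⊥) :
    ∃ A : PIdeal L, A.IsMinimal ∧ A.toLieIdeal ≤ K.toLieIdeal := by
  obtain ⟨A, ⟨hA0, hAK⟩, hmin⟩ := exists_minimalFor_of_wellFoundedLT
    (fun A : PIdeal L => A.toLieIdeal ≠ ⊥ ∧ A.toLieIdeal ≤ K.toLieIdeal)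
    (fun A => Module.finrank F A.toLieIdeal.toSubmodule) ⟨K, hK, le_rfl⟩
  refine ⟨A, ⟨hA0, fun B hB0 hBA => ?_⟩, hAK⟩
  have h := hmin (j := B) ⟨hB0, hBA.trans hAK⟩ (Submodule.finrank_mono hBA)
  exact LieSubmodule.toSubmodule_injective (Submodule.eq_of_le_of_finrank_le hBA h)

theorem exists_abelian_isMinimal [Fact p.Prime] (L : Alg.{u, v} p F) [Nontrivial L.carrier] :
    ∃ A : PIdeal L, A.IsMinimal ∧ ∀ x ∈ A.toLieIdeal, ∀ y ∈ A.toLieIdeal, ⁅x, y⁆ = 0 := by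
  obtain ⟨K, hK0, hK⟩ := exists_abelian_pIdeal L
  obtain ⟨A, hA, hAK⟩ := exists_isMinimal_le K hK0
  exact ⟨A, hA, fun x hx y hy => hK x (hAK hx) y (hAK hy)⟩

/-- A Lie ideal `A ≠ 0` on which every element of the Lie ideal `J` acts nilpotently contains a
nonzero element annihilated by `J`. -/
theorem exists_mem_ne_zero_lie_eq_zero {L : Alg.{u, v} p F} {J A : LieIdeal F L} (hA : A ≠ ⊥)
    (n : ℕ) (h : ∀ x ∈ J, ∀ a ∈ A, (LieAlgebra.ad F L x ^ n) a = 0) :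
    ∃ a ∈ A, a ≠ 0 ∧ ∀ x ∈ J, ⁅x, a⁆ = 0 := by
  -- Engel's theorem: elementwise nilpotent action makes `A` a nilpotent `J`-module, and a nonzero
  -- nilpotent module has a nonzero invariant.
  have hnil : LieModule.IsNilpotent J A := by
    rw [LieModule.isNilpotent_iff_forall' (R := F)]
    refine fun x => ⟨n, LinearMap.ext fun a => Subtype.ext ?_⟩
    refine Eq.trans ?_ (h x x.2 a a.2)
    exact LieSubmodule.coe_toEnd_pow F L L A x a n
  have : Nontrivial A := (LieSubmodule.nontrivial_iff_ne_bot F L L).2 hA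
  have := LieModule.nontrivial_max_triv_of_isNilpotent F J A
  obtain ⟨⟨a, ha⟩, hne⟩ := exists_ne (0 : LieModule.maxTrivSubmodule F J A)
  rw [LieModule.mem_maxTrivSubmodule] at ha
  refine ⟨a, a.2, fun h0 => hne (Subtype.ext (Subtype.ext h0)), fun x hx => ?_⟩
  exact congrArg Subtype.val (ha ⟨x, hx⟩)

/-- The elements of `A` annihilated by `J`, for ideals `A` and `J`. -/
def annihilated {L : Type v} [LieRing L] [LieAlgebra F L] (J A : LieIdeal F L) : LieIdeal F L where
  carrier := {a | a ∈ A ∧ ∀ x ∈ J, ⁅x, a⁆ = 0}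
  add_mem' {a b} ha hb := ⟨A.add_mem ha.1 hb.1, fun x hx => by
    rw [lie_add, ha.2 x hx, hb.2 x hx, add_zero]⟩
  zero_mem' := ⟨A.zero_mem, fun x _ => lie_zero x⟩
  smul_mem' c a ha := ⟨A.smul_mem c ha.1, fun x hx => by rw [lie_smul, ha.2 x hx, smul_zero]⟩
  lie_mem {y a} ha := ⟨lie_mem_right F L A _ _ ha.1, fun x hx => by
    rw [leibniz_lie, ha.2 x hx, lie_zero, add_zero, ha.2 _ (lie_mem_left F L J _ _ hx)]⟩

theorem mem_annihilated {L : Type v} [LieRing L] [LieAlgebra F L] {J A : LieIdeal F L} {a : L} :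
    a ∈ annihilated J A ↔ a ∈ A ∧ ∀ x ∈ J, ⁅x, a⁆ = 0 := Iff.rfl

/-! ### Self-centralizing minimal ideals and their complements -/

section Primitive

variable [Fact p.Prime] {L : Alg.{u, v} p F} {A : PIdeal L}

/-- The centre centralizes `A`, so it lies in `A` and equals `A` by minimality; then all of `L`
centralizes `A`. -/
theorem PIdeal.IsMinimal.eq_top_of_center_ne_bot (hA : A.IsMinimal)
    (hC : ∀ x : L, x ∈ A.toLieIdeal ↔ ∀ a ∈ A.toLieIdeal, ⁅x, a⁆ = 0)
    (hZ : (center L).toLieIdeal ≠ ⊥) (x : L) : x ∈ A.toLieIdeal := by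
  have h := hA.2 (center L) hZ fun z hz => (hC z).2 fun a _ => by
    rw [← lie_skew, mem_center.1 hz, neg_zero]
  exact (hC x).2 fun a ha => mem_center.1 (h ▸ ha) x

/-- The `p`-operation is zero on `A`, so Lie ideals inside `A` are `[p]`-ideals: `A` is minimal even
as a Lie ideal. -/
theorem PIdeal.IsMinimal.eq_of_le (hA : A.IsMinimal)
    (hC : ∀ x : L, x ∈ A.toLieIdeal ↔ ∀ a ∈ A.toLieIdeal, ⁅x, a⁆ = 0)
    (hZ : (center L).toLieIdeal = ⊥) {B : LieIdeal F L} (hB : B ≠ ⊥) (hBA : B ≤ A.toLieIdeal) :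
    B = A.toLieIdeal := by
  refine hA.2 ⟨B, fun x hx => ?_⟩ hB hBA
  have h := pOp_mem_center_of_mem_abelian (J := A.toLieIdeal)
    (fun x hx y hy => (hC x).1 hx y hy) (hBA hx)
  rw [hZ, LieSubmodule.mem_bot] at h
  rw [h]
  exact B.zero_mem

/-- The point is that `L / A` has nonzero centre. Otherwise the `p`-operation kills a nonzero
abelian ideal `J` of `L / A`, so the preimage of `J` acts nilpotently on `A`. By Engel and
minimality it annihilates `A`, hence lies in `A`, contradicting `J ≠ 0`. -/
theorem PIdeal.IsMinimal.exists_central_mod (hA : A.IsMinimal)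
    (hC : ∀ x : L, x ∈ A.toLieIdeal ↔ ∀ a ∈ A.toLieIdeal, ⁅x, a⁆ = 0)
    (hZ : (center L).toLieIdeal = ⊥) :
    ∃ b : L, b ∉ A.toLieIdeal ∧ ∀ x : L, ⁅x, b⁆ ∈ A.toLieIdeal := by
  have hne : ∃ x : L, x ∉ A.toLieIdeal := by
    by_contra! h
    obtain ⟨a, ha, ha0⟩ := exists_mem_ne_zero hA.1
    have : a ∈ (center L).toLieIdeal := mem_center.2 fun y => (hC y).1 (h y) a ha
    rw [hZ, LieSubmodule.mem_bot] at this
    exact ha0 this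
  obtain ⟨x₀, hx₀⟩ := hne
  have : Nontrivial (L.quotient A).carrier :=
    ⟨A.mkHom x₀, 0, fun h => hx₀ (PIdeal.mkHom_eq_zero.1 h)⟩
  by_cases hZ' : (center (L.quotient A)).toLieIdeal = ⊥
  · exfalso
    obtain ⟨J, hJ0, hJ⟩ := exists_abelian_lieIdeal (L.quotient A)
    obtain ⟨y, hyJ, hy0⟩ := exists_mem_ne_zero hJ0
    obtain ⟨y, rfl⟩ := A.mkHom_surjective y
    have hp : ∀ x ∈ J.comap A.mkHom.toLieHom, L.pOp.toFun x ∈ A.toLieIdeal := fun x hx => by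
      have h := pOp_mem_center_of_mem_abelian hJ (LieIdeal.mem_comap.1 hx)
      rw [hZ', LieSubmodule.mem_bot, ← A.mkHom.map_pOp] at h
      exact PIdeal.mkHom_eq_zero.1 h
    obtain ⟨a, ha, ha0, hann⟩ := exists_mem_ne_zero_lie_eq_zero (J := J.comap A.mkHom.toLieHom)
      hA.1 p fun x hx a ha => by rw [← lie_pOp]; exact (hC _).1 (hp x hx) a ha
    have h := hA.eq_of_le hC hZ (B := annihilated (J.comap A.mkHom.toLieHom) A.toLieIdeal)
      (fun h => ha0 ((LieSubmodule.mem_bot a).1 (h ▸ mem_annihilated.2 ⟨ha, hann⟩)))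
      fun x hx => hx.1
    refine hy0 (PIdeal.mkHom_eq_zero.2 ((hC y).2 fun a ha => ?_))
    rw [← h] at ha
    exact ha.2 y (LieIdeal.mem_comap.2 hyJ)
  · obtain ⟨b, hb, hb0⟩ := exists_mem_ne_zero hZ'
    obtain ⟨b, rfl⟩ := A.mkHom_surjective b
    refine ⟨b, fun h => hb0 (PIdeal.mkHom_eq_zero.2 h), fun x => PIdeal.mkHom_eq_zero.1 ?_⟩
    exact (LieHom.map_lie _ _ _).trans (mem_center.1 hb _)

/-- A self-centralizing minimal `[p]`-ideal has a complement. -/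
theorem PIdeal.IsMinimal.exists_complement (hA : A.IsMinimal)
    (hC : ∀ x : L, x ∈ A.toLieIdeal ↔ ∀ a ∈ A.toLieIdeal, ⁅x, a⁆ = 0) :
    ∃ E : PSubalgebra L, (∀ x : L, ∃ e ∈ E.toLieSubalgebra, x - e ∈ A.toLieIdeal) ∧
      ∀ e ∈ E.toLieSubalgebra, e ∈ A.toLieIdeal → e = 0 := by
  by_cases hZ : (center L).toLieIdeal = ⊥
  · obtain ⟨b, hb, hbA⟩ := hA.exists_central_mod hC hZ
    -- The kernel of `ad b` on `A` is an ideal because `⁅b, y⁆ ∈ A` acts as zero on `A`. It is not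
    -- `A`, since `b ∉ A`, so by minimality it is zero and `ad b` is bijective on `A`.
    let B : LieIdeal F L :=
      { carrier := {a | a ∈ A.toLieIdeal ∧ ⁅b, a⁆ = 0}
        add_mem' := fun {x y} hx hy =>
          ⟨A.toLieIdeal.add_mem hx.1 hy.1, by rw [lie_add, hx.2, hy.2, add_zero]⟩
        zero_mem' := ⟨A.toLieIdeal.zero_mem, lie_zero b⟩
        smul_mem' := fun c x hx =>
          ⟨A.toLieIdeal.smul_mem c hx.1, by rw [lie_smul, hx.2, smul_zero]⟩
        lie_mem := fun {y a} ha =>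
          ⟨lie_mem_right F L A.toLieIdeal _ _ ha.1, by
            rw [leibniz_lie, ha.2, lie_zero, add_zero, ← lie_skew b y, neg_lie,
              (hC _).1 (hbA y) a ha.1, neg_zero]⟩ }
    have hB : ∀ a ∈ A.toLieIdeal, ⁅b, a⁆ = 0 → a = 0 := by
      by_contra! h
      obtain ⟨a, ha, hba, ha0⟩ := h
      have h := hA.eq_of_le hC hZ (B := B)
        (fun h => ha0 ((LieSubmodule.mem_bot a).1 (h ▸ (show a ∈ B from ⟨ha, hba⟩))))
        fun x hx => hx.1
      refine hb ((hC b).2 fun c hc => ?_)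
      rw [← h] at hc
      exact hc.2
    let φ : A.toLieIdeal.toSubmodule →ₗ[F] A.toLieIdeal.toSubmodule :=
      (LieAlgebra.ad F L b).restrict fun a ha => lie_mem_right F L A.toLieIdeal _ _ ha
    have hφ : Function.Surjective φ := by
      refine LinearMap.injective_iff_surjective.1 ((injective_iff_map_eq_zero φ).2 fun a h => ?_)
      exact Subtype.ext (hB a a.2 (congrArg Subtype.val h))
    refine ⟨centralizer b, fun x => ?_, fun e he heA => hB e heA ?_⟩
    -- Solving `⁅b, a⁆ = ⁅x, b⁆` in `A` moves `x` into the centralizer of `b` by adding `a`.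
    · obtain ⟨a, ha⟩ := hφ ⟨⁅x, b⁆, hbA x⟩
      have ha' : ⁅b, (a : L.carrier)⁆ = ⁅x, b⁆ := congrArg Subtype.val ha
      refine ⟨x + a, mem_centralizer.2 ?_, ?_⟩
      · rw [add_lie, ← lie_skew (a : L.carrier) b, ha', add_neg_cancel]
      · rw [sub_add_cancel_left]
        exact A.toLieIdeal.neg_mem a.2
    · rw [← lie_skew, mem_centralizer.1 he, neg_zero]
  -- Here `A` is all of `L`, so zero is a complement.
  · refine ⟨⟨⊥, fun x hx => ?_⟩, fun x => ⟨0, LieSubalgebra.zero_mem _, ?_⟩, fun e he _ => ?_⟩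
    · rw [LieSubalgebra.mem_bot] at hx ⊢
      rw [hx, L.pOp.toFun_zero]
    · exact hA.eq_top_of_center_ne_bot hC hZ _
    · exact (LieSubalgebra.mem_bot _).1 he

end Primitive

/-! ### Classes -/

/-- The identity homomorphism. -/
def PHom.id (L : Alg.{u, v} p F) : PHom L L := ⟨LieHom.id, fun _ => rfl⟩

theorem PHom.id_surjective (L : Alg.{u, v} p F) : Function.Surjective (PHom.id L) :=
  fun x => ⟨x, rfl⟩

theorem PHom.iso_symm_of_bijective {L M : Alg.{u, v} p F} (f : PHom L M)
    (hf : Function.Bijective f) : Iso M L :=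
  f.exists_iso hf.2 (PHom.id L) (PHom.id_surjective L) fun _ => map_eq_zero_iff f.toLieHom hf.1

theorem Iso.exists_pHom {L M : Alg.{u, v} p F} (h : Iso L M) :
    ∃ f : PHom L M, Function.Bijective f := by
  obtain ⟨e, he⟩ := h
  exact ⟨⟨e, he⟩, e.bijective⟩

theorem PHom.injective_of_ker [Fact p.Prime] {L M : Alg.{u, v} p F} {f : PHom L M}
    (h : f.ker.toLieIdeal = ⊥) : Function.Injective f :=
  (injective_iff_map_eq_zero f.toLieHom).2 fun x hx =>
    (LieSubmodule.mem_bot x).1 (h ▸ PHom.mem_ker.2 hx)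

theorem PSubalgebra.subtype_bijective {L : Alg.{u, v} p F} {U : PSubalgebra L}
    (h : ∀ x : L, x ∈ U.toLieSubalgebra) : Function.Bijective U.subtype :=
  ⟨U.subtype_injective, fun x => ⟨⟨x, h x⟩, rfl⟩⟩

/-- The restriction of a homomorphism to a `[p]`-subalgebra and its image. -/
def PHom.restrict {L M : Alg.{u, v} p F} (f : PHom L M) (U : PSubalgebra L) :
    PHom U.toAlg (f.map U).toAlg :=
  (f.comp U.subtype).codRestrict _ fun x => ⟨x.1, x.2, rfl⟩

theorem PHom.restrict_surjective {L M : Alg.{u, v} p F} (f : PHom L M) (U : PSubalgebra L) :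
    Function.Surjective (f.restrict U) := by
  rintro ⟨_, x, hx, rfl⟩
  exact ⟨⟨x, hx⟩, rfl⟩

/-- The restriction of a homomorphism to the preimage of a `[p]`-subalgebra. -/
def PHom.restrictPreimage {L M : Alg.{u, v} p F} (f : PHom L M) (U : PSubalgebra M) :
    PHom (f.comap U).toAlg U.toAlg :=
  (f.comp (f.comap U).subtype).codRestrict U fun x => x.2

theorem PHom.restrictPreimage_surjective {L M : Alg.{u, v} p F} {f : PHom L M}
    (hf : Function.Surjective f) (U : PSubalgebra M) :
    Function.Surjective (f.restrictPreimage U) := by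
  rintro ⟨y, hy⟩
  obtain ⟨x, rfl⟩ := hf y
  exact ⟨⟨x, hy⟩, rfl⟩

theorem IsClass.mem_of_bijective {X : Set (Alg.{u, v} p F)} (hX : IsClass X)
    {L M : Alg.{u, v} p F} (f : PHom L M)
    (hf : Function.Bijective f) (hM : M ∈ X) : L ∈ X :=
  hX _ _ hM (f.iso_symm_of_bijective hf)

theorem IsPrimitive.of_iso {L M : Alg.{u, v} p F} (h : Iso L M) (hL : IsPrimitive L) :
    IsPrimitive M := by
  obtain ⟨f, hf⟩ := h.exists_pHom
  obtain ⟨A, hA, hC⟩ := hL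
  have hmem : ∀ x, f x ∈ (f.mapIdeal hf.2 A).toLieIdeal ↔ x ∈ A.toLieIdeal := fun x => by
    rw [PHom.mem_mapIdeal]
    exact ⟨fun ⟨y, hy, e⟩ => hf.1 e ▸ hy, fun hx => ⟨x, hx, rfl⟩⟩
  refine ⟨f.mapIdeal hf.2 A, ⟨fun h => ?_, fun B hB hBA => ?_⟩, hf.2.forall.2 fun x => ?_⟩
  · obtain ⟨a, ha, ha0⟩ := exists_mem_ne_zero hA.1
    have := (hmem a).2 ha
    rw [h, LieSubmodule.mem_bot] at this
    exact ha0 ((map_eq_zero_iff f.toLieHom hf.1).1 this)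
  · have h := hA.2 (f.comapIdeal B) (fun h => ?_) fun x hx =>
      (hmem x).1 (hBA (PHom.mem_comapIdeal.1 hx))
    · refine le_antisymm hBA fun y hy => ?_
      obtain ⟨a, ha, rfl⟩ := PHom.mem_mapIdeal.1 hy
      rw [← h] at ha
      exact PHom.mem_comapIdeal.1 ha
    · obtain ⟨b, hb, hb0⟩ := exists_mem_ne_zero hB
      obtain ⟨b, rfl⟩ := hf.2 b
      have : b ∈ (f.comapIdeal B).toLieIdeal := PHom.mem_comapIdeal.2 hb
      rw [h, LieSubmodule.mem_bot] at this
      exact hb0 (by rw [this, map_zero])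
  · rw [hmem, hC]
    refine ⟨?_, fun h a ha => ?_⟩
    · rintro h _ ⟨a, ha, rfl⟩
      refine (f.toLieHom.map_lie x a).symm.trans ?_
      rw [h a ha, map_zero]
    · have := (f.toLieHom.map_lie x a).trans (h _ ((hmem a).2 ha))
      exact (map_eq_zero_iff f.toLieHom hf.1).1 this

/-- The `[p]`-ideal `U ∩ A`, where `A` is an abelian `[p]`-ideal with `U + A = L`. -/
def PSubalgebra.infIdeal {L : Alg.{u, v} p F} (U : PSubalgebra L) (A : PIdeal L)
    (hA : ∀ x ∈ A.toLieIdeal, ∀ y ∈ A.toLieIdeal, ⁅x, y⁆ = 0)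
    (hUA : ∀ x : L, ∃ e ∈ U.toLieSubalgebra, x - e ∈ A.toLieIdeal) : PIdeal L where
  toLieIdeal :=
    { U.toLieSubalgebra.toSubmodule ⊓ A.toLieIdeal.toSubmodule with
      lie_mem := by
        rintro y x ⟨hxU, hxA⟩
        obtain ⟨e, he, hy⟩ := hUA y
        -- Since `A` is abelian, only the component of `y` in `U` acts on `U ∩ A`.
        have h : ⁅y, x⁆ = ⁅e, x⁆ := by rw [← sub_eq_zero, ← sub_lie, hA _ hy _ hxA]
        exact ⟨h ▸ U.toLieSubalgebra.lie_mem he hxU, lie_mem_right F L A.toLieIdeal _ _ hxA⟩ }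
  pOp_mem x hx := ⟨U.pOp_mem x hx.1, A.pOp_mem x hx.2⟩

theorem PSubalgebra.mem_infIdeal {L : Alg.{u, v} p F} {U : PSubalgebra L} {A : PIdeal L}
    {hA : ∀ x ∈ A.toLieIdeal, ∀ y ∈ A.toLieIdeal, ⁅x, y⁆ = 0}
    {hUA : ∀ x : L, ∃ e ∈ U.toLieSubalgebra, x - e ∈ A.toLieIdeal} {x : L} :
    x ∈ (U.infIdeal A hA hUA).toLieIdeal ↔ x ∈ U.toLieSubalgebra ∧ x ∈ A.toLieIdeal := Iff.rfl

section Homomorph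

variable [Fact p.Prime] {X : Set (Alg.{u, v} p F)}

theorem IsPHomomorph.mem_of_surjective (hX : IsPHomomorph X) {L M : Alg.{u, v} p F} (f : PHom L M)
    (hf : Function.Surjective f) (hL : L ∈ X) : M ∈ X := by
  rw [← hX.2.2]
  exact ⟨L, hL, f.ker, PHom.exists_iso _ f.ker.mkHom_surjective f hf fun x => by simp⟩

theorem IsClass.quotient_ker_mem (hX : IsClass X) {L M : Alg.{u, v} p F} (f : PHom L M)
    (hf : Function.Surjective f) (hM : M ∈ X) : L.quotient f.ker ∈ X :=
  hX _ _ hM (PHom.exists_iso f hf _ f.ker.mkHom_surjective fun x => by simp)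

/-- Phrased with surjections, the condition visibly passes to quotients by composition. -/
theorem IsClass.mem_prim_iff (hX : IsClass X) {L : Alg.{u, v} p F} :
    L ∈ prim X ↔ ∀ (M : Alg.{u, v} p F) (f : PHom L M), Function.Surjective f →
      IsPrimitive M → M ∈ X := by
  refine ⟨fun h M f hf hM => ?_, fun h K hK => h _ K.mkHom K.mkHom_surjective hK⟩
  exact hX _ _ (h f.ker (hM.of_iso (PHom.exists_iso f hf _ f.ker.mkHom_surjective fun x => by simp)))
    (PHom.exists_iso _ f.ker.mkHom_surjective f hf fun x => by simp)

/-! ### Covering subalgebras and projectors -/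

/-- `E` is in `X` and, for every `[p]`-subalgebra `V` containing `E`, is mapped onto every image
of `V` that is in `X`. -/
def PSubalgebra.Covers {L : Alg.{u, v} p F} (E : PSubalgebra L) (X : Set (Alg.{u, v} p F)) :
    Prop :=
  E.toAlg ∈ X ∧ ∀ V : PSubalgebra L, E.toLieSubalgebra ≤ V.toLieSubalgebra →
    ∀ N ∈ X, ∀ f : PHom V.toAlg N, Function.Surjective f →
      ∀ v, ∃ u, V.subtype u ∈ E.toLieSubalgebra ∧ f u = f v

/-- The equation `U + K = V` says that `U` maps onto `V / K`; quotients of `V` are traded for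
arbitrary surjections from `V`. -/
theorem IsPHomomorph.covers_iff (hX : IsPHomomorph X) {L : Alg.{u, v} p F} {E : PSubalgebra L} :
    E.Covers X ↔ E.IsCovering X := by
  refine and_congr_right fun _ => forall₂_congr fun V hEV => ⟨fun h K hK => ?_, ?_⟩
  · refine le_antisymm (sup_le hEV ?_) fun v hv => ?_
    · rintro _ ⟨x, -, rfl⟩
      exact x.2
    · obtain ⟨u, hu, e⟩ := h _ hK K.mkHom K.mkHom_surjective ⟨v, hv⟩
      refine Submodule.mem_sup.2 ⟨_, hu, _, ⟨(show V.toAlg.carrier from ⟨v, hv⟩) - u, ?_, rfl⟩, ?_⟩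
      · refine PIdeal.mkHom_eq_zero.1 ?_
        rw [map_sub, e, sub_self]
      · exact add_sub_cancel _ _
  · intro h N hN f hf v
    have hv : V.subtype v ∈ V.toLieSubalgebra.toSubmodule := v.2
    rw [← h f.ker (hX.1.quotient_ker_mem f hf hN), Submodule.mem_sup] at hv
    obtain ⟨e, he, _, ⟨k, hk, rfl⟩, hek⟩ := hv
    obtain ⟨e, rfl⟩ := PSubalgebra.exists_subtype_eq (hEV he)
    have hv : e + (show V.toAlg.carrier from k) = v := V.subtype_injective hek
    exact ⟨e, he, by rw [← hv, map_add, PHom.mem_ker.1 hk, add_zero]⟩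

theorem PSubalgebra.Covers.isProjector (hX : IsPHomomorph X) {L : Alg.{u, v} p F}
    {E : PSubalgebra L} (hE : E.Covers X) : E.IsProjector X := by
  refine fun K => ⟨hX.mem_of_surjective (K.mkHom.restrict E) (K.mkHom.restrict_surjective E) hE.1,
    fun V hV hEV => le_antisymm (fun y hy => ?_) hEV⟩
  obtain ⟨v, hv⟩ := PHom.restrictPreimage_surjective K.mkHom_surjective V ⟨y, hy⟩
  obtain ⟨u, hu, e⟩ := hE.2 (K.mkHom.comap V) (fun x hx => hEV ⟨x, hx, rfl⟩) _ hV
    (K.mkHom.restrictPreimage V) (PHom.restrictPreimage_surjective K.mkHom_surjective V) v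
  exact ⟨_, hu, congrArg Subtype.val (e.trans hv)⟩

/-! ### Projective classes are Schunck classes -/

/-- An algebra is primitive if it has a proper `[p]`-subalgebra supplementing every nonzero
`[p]`-ideal. -/
theorem isPrimitive_of_supplement {L : Alg.{u, v} p F} (E : PSubalgebra L) {x₀ : L}
    (hx₀ : x₀ ∉ E.toLieSubalgebra)
    (hE : ∀ K : PIdeal L, K.toLieIdeal ≠ ⊥ →
      ∀ x : L, ∃ e ∈ E.toLieSubalgebra, x - e ∈ K.toLieIdeal) : IsPrimitive L := by
  -- A nonzero `[p]`-ideal inside `E` could not supplement the proper subalgebra `E`.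
  have hle : ∀ K : PIdeal L, (∀ x ∈ K.toLieIdeal, x ∈ E.toLieSubalgebra) →
      K.toLieIdeal = ⊥ := fun K hK => by
    by_contra h
    obtain ⟨e, he, hxe⟩ := hE K h x₀
    have := E.toLieSubalgebra.add_mem (hK _ hxe) he
    rw [sub_add_cancel] at this
    exact hx₀ this
  have : Nontrivial L.carrier :=
    ⟨x₀, 0, fun h => hx₀ (h ▸ E.toLieSubalgebra.zero_mem)⟩
  obtain ⟨A, hA, hAA⟩ := exists_abelian_isMinimal L
  have hEA := hE A hA.1
  -- The centralizer of `A` in `E` is normalized by `E` and annihilated by `A`, so it is an ideal of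
  -- `L = E + A`. Lying in `E`, it is zero, and the centralizer of `A` in `L` is then `A` itself.
  let C : PIdeal L :=
    { toLieIdeal :=
        { carrier := {x | x ∈ E.toLieSubalgebra ∧ ∀ a ∈ A.toLieIdeal, ⁅x, a⁆ = 0}
          add_mem' := fun {x y} hx hy => ⟨E.toLieSubalgebra.add_mem hx.1 hy.1, fun a ha => by
            rw [add_lie, hx.2 a ha, hy.2 a ha, add_zero]⟩
          zero_mem' := ⟨E.toLieSubalgebra.zero_mem, fun a _ => zero_lie a⟩
          smul_mem' := fun c x hx => ⟨E.toLieSubalgebra.smul_mem c hx.1, fun a ha => by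
            rw [smul_lie, hx.2 a ha, smul_zero]⟩
          lie_mem := fun {y x} hx => by
            obtain ⟨e, he, hy⟩ := hEA y
            have h : ⁅y, x⁆ = ⁅e, x⁆ := by
              rw [← sub_eq_zero, ← sub_lie, ← lie_skew, hx.2 _ hy, neg_zero]
            refine ⟨h ▸ E.toLieSubalgebra.lie_mem he hx.1, fun a ha => ?_⟩
            rw [lie_lie, hx.2 a ha, lie_zero, hx.2 _ (lie_mem_right F L A.toLieIdeal _ _ ha),
              sub_zero] }
      pOp_mem := fun x hx => ⟨E.pOp_mem x hx.1, fun a ha => pOp_lie_eq_zero (hx.2 a ha)⟩ }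
  have hC := hle C fun x hx => hx.1
  refine ⟨A, hA, fun x => ⟨fun hx => hAA x hx, fun hx => ?_⟩⟩
  obtain ⟨e, he, hxe⟩ := hEA x
  have heC : e ∈ C.toLieIdeal := ⟨he, fun a ha => by
    have := hAA _ hxe a ha
    rwa [sub_lie, hx a ha, zero_sub, neg_eq_zero] at this⟩
  rw [hC, LieSubmodule.mem_bot] at heC
  rwa [heC, sub_zero] at hxe

theorem IsProjective.isPSchunckClass (hX : IsPHomomorph X) (h : IsProjective X) :
    IsPSchunckClass X := by
  refine ⟨hX.1, hX.2.1, Set.Subset.antisymm (fun L hL => ?_) fun L hL =>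
    hX.1.mem_prim_iff.2 fun M f hf _ => hX.mem_of_surjective f hf hL⟩
  induction hn : Module.finrank F L.carrier using Nat.strong_induction_on generalizing L with
  | _ n ih =>
    subst hn
    by_contra hLX
    have hq : ∀ K : PIdeal L, K.toLieIdeal ≠ ⊥ → L.quotient K ∈ X := fun K hK =>
      ih _ (PIdeal.finrank_quotient_lt hK) _ (hX.1.mem_prim_iff.2 fun M f hf hM =>
        hX.1.mem_prim_iff.1 hL M (f.comp K.mkHom) (hf.comp K.mkHom_surjective) hM) rfl
    obtain ⟨E, hE⟩ := h L
    -- The projector condition at `K = 0`, transported along `E ≅ (E + 0) / 0`.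
    have hEX : E.toAlg ∈ X := by
      refine hX.1.mem_of_bijective ((PIdeal.zero L).mkHom.restrict E)
        ⟨(injective_iff_map_eq_zero ((PIdeal.zero L).mkHom.restrict E).toLieHom).2 fun x hx => ?_,
          (PIdeal.zero L).mkHom.restrict_surjective E⟩ (hE (PIdeal.zero L)).1
      exact Subtype.ext (PIdeal.mem_zero.1 (PIdeal.mkHom_eq_zero.1 (congrArg Subtype.val hx)))
    obtain ⟨x₀, hx₀⟩ : ∃ x : L, x ∉ E.toLieSubalgebra := by
      by_contra! hall
      exact hLX (hX.mem_of_surjective E.subtype (PSubalgebra.subtype_bijective hall).2 hEX)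
    refine hLX (hX.1.mem_prim_iff.1 hL L (PHom.id L) (PHom.id_surjective L)
      (isPrimitive_of_supplement E hx₀ fun K hK x => ?_))
    -- As `L / K ∈ X`, maximality of `(E + K) / K` gives `E + K = L`.
    have hfull := (hE K).2 (PSubalgebra.full _) (hX.1.mem_of_bijective
      (PSubalgebra.full (L.quotient K)).subtype
      (PSubalgebra.subtype_bijective PSubalgebra.mem_full) (hq K hK)) le_top
    have hx : K.mkHom x ∈ (E.map K).toLieSubalgebra := hfull ▸ PSubalgebra.mem_full _
    obtain ⟨e, he, hex⟩ := hx
    refine ⟨e, he, PIdeal.mkHom_eq_zero.1 ?_⟩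
    rw [map_sub, sub_eq_zero]
    exact hex.symm

/-! ### Covering subalgebras for Schunck classes -/

theorem PSubalgebra.Covers.trans (hX : IsPHomomorph X) {L M : Alg.{u, v} p F} {π : PHom L M}
    (hπ : Function.Surjective π) {U : PSubalgebra M} (hU : U.Covers X)
    {E : PSubalgebra (π.comap U).toAlg} (hE : E.Covers X) :
    ((π.comap U).subtype.map E).Covers X := by
  refine ⟨hX.mem_of_surjective _ ((π.comap U).subtype.restrict_surjective E) hE.1,
    fun V hEV N hN f hf => ?_⟩
  -- `U` is itself an image in `X` of its preimage, so `E` maps onto `U`; thus `E ≤ V` gives `U ≤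
  -- π(V)`.
  have hEU : ∀ y ∈ U.toLieSubalgebra, ∃ e ∈ E.toLieSubalgebra,
      π ((π.comap U).subtype e) = y := fun y hy => by
    obtain ⟨w, hw⟩ := PHom.restrictPreimage_surjective hπ U ⟨y, hy⟩
    obtain ⟨u, hu, e⟩ := hE.2 (PSubalgebra.full _) le_top _ hU.1
      ((π.restrictPreimage U).comp (PSubalgebra.full _).subtype)
      ((PHom.restrictPreimage_surjective hπ U).comp
        (PSubalgebra.subtype_bijective PSubalgebra.mem_full).2) ⟨w, PSubalgebra.mem_full w⟩
    exact ⟨_, hu, congrArg Subtype.val (e.trans hw)⟩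
  -- With `D = f(V ∩ ker π)`, the algebra `N / D` is an image of `π(V)` lying in `X`, so `U` covers
  -- it. Correcting a lift by an element of `V ∩ ker π` shows that `V ∩ π⁻¹(U)` already maps onto
  -- `N`.
  have hsplit : ∀ v, ∃ w, π (V.subtype w) ∈ U.toLieSubalgebra ∧ f w = f v := fun v => by
    let D := f.mapIdeal hf (π.restrict V).ker
    obtain ⟨k, hk⟩ := (π.restrict V).exists_lift (π.restrict_surjective V) (D.mkHom.comp f)
      fun x hx => PIdeal.mkHom_eq_zero.2 (PHom.mem_mapIdeal.2 ⟨x, PHom.mem_ker.2 hx, rfl⟩)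
    have hks : Function.Surjective k := fun y => by
      obtain ⟨x, rfl⟩ := (D.mkHom_surjective.comp hf) y
      exact ⟨_, hk x⟩
    obtain ⟨y, hy, hyv⟩ := hU.2 (π.map V)
      (fun y hy => by
        obtain ⟨e, he, rfl⟩ := hEU y hy
        exact ⟨_, hEV ⟨e, he, rfl⟩, rfl⟩)
      _ (hX.mem_of_surjective D.mkHom D.mkHom_surjective hN) k hks (π.restrict V v)
    obtain ⟨e, rfl⟩ := π.restrict_surjective V y
    rw [hk, hk, PHom.comp_apply, PHom.comp_apply, eq_comm, ← sub_eq_zero, ← map_sub,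
      PIdeal.mkHom_eq_zero] at hyv
    obtain ⟨x, hx, hxe⟩ := PHom.mem_mapIdeal.1 hyv
    refine ⟨e + x, ?_, by rw [map_add, hxe, add_sub_cancel]⟩
    have hx0 : π (V.subtype x) = 0 := congrArg Subtype.val (PHom.mem_ker.1 hx)
    rw [map_add, map_add, hx0, add_zero]
    exact hy
  intro v
  -- It remains to use the covering property of `E` for `V ∩ π⁻¹(U)`, inside the preimage of `U`.
  let W : PSubalgebra (π.comap U).toAlg := (π.comap U).subtype.comap V
  let g : PHom W.toAlg N := f.comp ((π.comap U).subtype.restrictPreimage V)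
  have hg : ∀ v, ∃ w, g w = f v := fun v => by
    obtain ⟨w, hw, e⟩ := hsplit v
    exact ⟨⟨⟨w.1, hw⟩, w.2⟩, e⟩
  obtain ⟨w, hw⟩ := hg v
  obtain ⟨u, hu, e⟩ := hE.2 W (fun x hx => hEV ⟨x, hx, rfl⟩) N hN g (fun n => by
    obtain ⟨v, rfl⟩ := hf n
    exact hg v) w
  exact ⟨(π.comap U).subtype.restrictPreimage V u, ⟨_, hu, rfl⟩, e.trans hw⟩

/-- A complement `E` of `A` works: it is isomorphic to `L / A`, a subalgebra strictly containing it
is `L`, and any image of `L` in `X` has a kernel containing `A`. -/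
theorem PIdeal.IsMinimal.exists_covers (hX : IsPHomomorph X) {L : Alg.{u, v} p F} {A : PIdeal L}
    (hA : A.IsMinimal) (hC : ∀ x : L, x ∈ A.toLieIdeal ↔ ∀ a ∈ A.toLieIdeal, ⁅x, a⁆ = 0)
    (hL : L ∉ X) (hLA : L.quotient A ∈ X) : ∃ E : PSubalgebra L, E.Covers X := by
  obtain ⟨E, hEA, hE0⟩ := hA.exists_complement hC
  have hAA : ∀ x ∈ A.toLieIdeal, ∀ y ∈ A.toLieIdeal, ⁅x, y⁆ = 0 := fun x hx => (hC x).1 hx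
  have hinf : ∀ B : PIdeal L, (∃ x ∈ B.toLieIdeal, x ∈ A.toLieIdeal ∧ x ≠ 0) →
      A.toLieIdeal ≤ B.toLieIdeal := fun B ⟨x, hxB, hxA, hx0⟩ => by
    have h := hA.2 ⟨B.toLieIdeal ⊓ A.toLieIdeal, fun x hx =>
      ⟨B.pOp_mem x hx.1, A.pOp_mem x hx.2⟩⟩ (fun h => hx0 ?_) inf_le_right
    · exact inf_eq_right.1 h
    · change B.toLieIdeal ⊓ A.toLieIdeal = ⊥ at h
      have hx : x ∈ B.toLieIdeal ⊓ A.toLieIdeal := ⟨hxB, hxA⟩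
      rwa [h, LieSubmodule.mem_bot] at hx
  refine ⟨E, ?_, fun V hEV N hN f hf v => ?_⟩
  · refine hX.1.mem_of_bijective (A.mkHom.comp E.subtype)
      ⟨(injective_iff_map_eq_zero (A.mkHom.comp E.subtype).toLieHom).2 fun x hx => ?_,
        A.mkHom_surjective.forall.2 fun x => ?_⟩ hLA
    · exact Subtype.ext (hE0 _ x.2 (PIdeal.mkHom_eq_zero.1 hx))
    · obtain ⟨e, he, hxe⟩ := hEA x
      refine ⟨⟨e, he⟩, ?_⟩
      have := PIdeal.mkHom_eq_zero.2 hxe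
      rw [map_sub, sub_eq_zero] at this
      exact this.symm
  by_cases hv : V.subtype v ∈ E.toLieSubalgebra
  · exact ⟨v, hv, rfl⟩
  have hVA : ∀ x : L, ∃ e ∈ V.toLieSubalgebra, x - e ∈ A.toLieIdeal := fun x =>
    (hEA x).imp fun e he => ⟨hEV he.1, he.2⟩
  obtain ⟨e, he, hve⟩ := hEA (V.subtype v)
  -- If `v ∉ E`, its `A`-component `v - e` is a nonzero element of the ideal `V ∩ A`, so `A ≤ V`.
  have hAV := hinf (V.infIdeal A hAA hVA) ⟨_, PSubalgebra.mem_infIdeal.2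
    ⟨V.toLieSubalgebra.sub_mem (V.subtype_mem v) (hEV he), hve⟩, hve, fun h => hv ?_⟩
  swap
  · rwa [sub_eq_zero.1 h]
  have hV : ∀ x : L, x ∈ V.toLieSubalgebra := fun x => by
    obtain ⟨e, he, hxe⟩ := hVA x
    have := V.toLieSubalgebra.add_mem (PSubalgebra.mem_infIdeal.1 (hAV hxe)).1 he
    rwa [sub_add_cancel] at this
  let g : PHom L N := f.comp ((PHom.id L).codRestrict V hV)
  have hg : Function.Surjective g := fun n => by
    obtain ⟨x, rfl⟩ := hf n
    exact ⟨V.subtype x, rfl⟩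
  have hgk : g.ker.toLieIdeal ≠ ⊥ := fun h =>
    hL (hX.1.mem_of_bijective g ⟨PHom.injective_of_ker h, hg⟩ hN)
  -- If the kernel met `A` trivially, it would commute with `A`, hence lie in `A`, hence be zero;
  -- but `L ∉ X` makes it nonzero.
  have hAg : A.toLieIdeal ≤ g.ker.toLieIdeal := by
    refine hinf _ ?_
    by_contra! h
    obtain ⟨x, hx, hx0⟩ := exists_mem_ne_zero hgk
    refine hx0 (h x hx ((hC x).2 fun a ha => h _ ?_ ?_))
    · exact lie_mem_left F L g.ker.toLieIdeal _ _ hx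
    · exact lie_mem_right F L A.toLieIdeal _ _ ha
  refine ⟨⟨e, hEV he⟩, he, ?_⟩
  have := PHom.mem_ker.1 (hAg hve)
  rw [map_sub, sub_eq_zero] at this
  exact this.symm

theorem IsPSchunckClass.exists_covers (hX : IsPHomomorph X) (h : IsPSchunckClass X)
    (L : Alg.{u, v} p F) : ∃ E : PSubalgebra L, E.Covers X := by
  induction hn : Module.finrank F L.carrier using Nat.strong_induction_on generalizing L with
  | _ n ih =>
    subst hn
    by_cases hL : L ∈ X
    · exact ⟨PSubalgebra.full L, hX.1.mem_of_bijective (PSubalgebra.full L).subtype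
        (PSubalgebra.subtype_bijective PSubalgebra.mem_full) hL,
        fun V _ N _ f _ v => ⟨v, PSubalgebra.mem_full _, rfl⟩⟩
    by_cases hK : ∃ K : PIdeal L, K.toLieIdeal ≠ ⊥ ∧ L.quotient K ∉ X
    · obtain ⟨K, hK, hKX⟩ := hK
      obtain ⟨U, hU⟩ := ih _ (PIdeal.finrank_quotient_lt hK) _ rfl
      obtain ⟨x, hx⟩ : ∃ x, x ∉ U.toLieSubalgebra := by
        by_contra! hall
        exact hKX (hX.mem_of_surjective U.subtype (PSubalgebra.subtype_bijective hall).2 hU.1)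
      obtain ⟨x, rfl⟩ := K.mkHom_surjective x
      obtain ⟨E, hE⟩ := ih _ (PSubalgebra.finrank_toAlg_lt (U := K.mkHom.comap U) (x := x) hx) _ rfl
      exact ⟨_, hU.trans hX K.mkHom_surjective hE⟩
    · push Not at hK
      have hL' := hL
      rw [← h.2.2, h.1.mem_prim_iff] at hL'
      push Not at hL'
      obtain ⟨M, f, hf, hM, hMX⟩ := hL'
      -- Every proper quotient is in `X`, so the primitive image outside `X` can only be `L` itself.
      have hker : f.ker.toLieIdeal = ⊥ := by
        by_contra hne
        exact hMX (hX.1 _ _ (hK _ hne)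
          (PHom.exists_iso _ f.ker.mkHom_surjective f hf fun x => by simp))
      obtain ⟨A, hA, hC⟩ :=
        hM.of_iso (f.iso_symm_of_bijective ⟨PHom.injective_of_ker hker, hf⟩)
      exact hA.exists_covers hX hC hL (hK A hA.1)

end Homomorph

end RestrictedLie

theorem mainTheorem1 {p : ℕ} [Fact p.Prime] {F : Type u} [Field F] [CharP F p]
    (X : Set (RestrictedLie.Alg.{u, v} p F)) (hX : RestrictedLie.IsPHomomorph X) :
    [RestrictedLie.IsGaschutzClass X,
      RestrictedLie.IsProjective X,
      RestrictedLie.IsPSchunckClass X].TFAE := by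
  tfae_have 1 → 2 := fun h L => (h L).imp fun _ hE => (hX.covers_iff.2 hE).isProjector hX
  tfae_have 2 → 3 := fun h => h.isPSchunckClass hX
  tfae_have 3 → 1 := fun h L => (h.exists_covers hX L).imp fun _ hE => hX.covers_iff.1 hE
  tfae_finish
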